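/- **Setting.** Let $N\ge 1$, let $\Omega\subset\mathbb R^N$ be a nonempty bounded open set with Lipschitz boundary, $T>0$ and $\Omega_T=\Omega\times(0,T)$. The symbols $\nabla$ and $\nabla\cdot$ denote the spatial gradient and divergence and $n$ is the spatial part of the outward unit normal. Let $\Gamma_{in},\Gamma_{out}$ be disjoint subsets of the lateral boundary $\partial\Omega\times(0,T)$, each differing from its closure by an $\mathcal H^N$-null set, such that $\partial\Omega_T=\overline{\Gamma_{in}\cup\Gamma_{out}\cup(\Omega\times\{0\})\cup(\Omega\times\{T\})}$. Let $\{K_m\}$ be a finite family of pairwise disjoint nonempty open sets with Lipschitz boundary such that $\Omega_T=\operatorname{int}\bigcup_m\overline{K_m}$, and let $h_m=\operatorname{diam}K_m$. For an open set $O\subset\Omega_T$ let $H^1(O)$ be the usual space-time Sobolev space and $H(\mathrm{div},O)=\{w\in L^2(O)^N:\nabla\cdot w\in L^2(O)\}$. Let $V$ be the space of all $(v,w)\in L^2(\Omega_T)\times L^2(\Omega_T)^N$ with $v|_{K_m}\in H^1(K_m)$ and $w|_{K_m}\in H(\mathrm{div},K_m)$ for every $m$, with $$((r,z);(v,w))_V=\sum_m\int_{K_m}\big[h_m^2\nabla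 r\cdot\nabla v+rv+h_m^2(\nabla\cdot z)(\nabla\cdot w)+z\cdot w\big]\,dx,\qquad \|y\|_V=(y;y)_V^{1/2}.$$ **Data.** Let $D$ be a symmetric, bounded measurable, uniformly elliptic matrix field on $\Omega_T$ and $f\in L^2(\Omega_T)$. Let $b\in L^2(\Omega_T)^N$ have a divergence in $L^2(K_m)$ on every element and be such that $vb$ and $v\,\nabla\cdot b$ (elementwise divergence) are square integrable for every $v\in L^2(\Omega_T)$ with $v|_{K_m}\in H^1(K_m)$ for all $m$. Let $u_{in}$ be (the restriction to $\Gamma_{in}$ of) the trace of a function in $H^1(\Omega_T)$, $g$ (the restriction to $\Gamma_{out}$ of) the normal trace of an $L^2(\Omega_T)^{N+1}$ field with space-time divergence in $L^2(\Omega_T)$, and $u_0\in L^2(\Omega)$. Let $U$ be the set of all $(u,q)\in H^1(\Omega_T)\times H(\mathrm{div},\Omega_T)$ such that $u$ has trace $u_0$ on $\Omega\times\{0\}$. **Forms.** With the trace $\gamma_0$ and the normal trace $\gamma_n$ on $\partial K_m$, for $(u,q)\in H^1(\Omega_T)\times H(\mathrm{div},\Omega_T)$ and $(v,w)\in V$ put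 $$B((u,q);(v,w))=\sum_m\Big\{\int_{K_m}\big[-u\,\nabla\cdot(Dw)-q\cdot w+\partial_tu\,v+q\cdot\nabla v-(b\cdot\nabla v)u\big]dx+\oint_{\partial K_m\setminus\Gamma_{in}}\big[(b\cdot n)\gamma_0(u)\gamma_0(v)+\gamma_n(Dw)\gamma_0(u)\big]ds-\oint_{\partial K_m\setminus\Gamma_{out}}\gamma_n(q)\gamma_0(v)\,ds\Big\},$$ $$F((v,w))=\sum_m\Big\{\int_{K_m}fv\,dx+\oint_{\partial K_m\cap\Gamma_{out}}g\,\gamma_0(v)\,ds-\oint_{\partial K_m\cap\Gamma_{in}}\big[u_{in}\gamma_n(Dw)+(b\cdot n)u_{in}\gamma_0(v)\big]ds\Big\}.$$ Here boundary integrals with normal traces are the duality pairings given by Green's identity, $\langle\gamma_n(p),\gamma_0(z)\rangle_{\partial K}=\int_K(p\cdot\nabla z+z\,\nabla\cdot p)\,dx$ (for $g$ with the space-time gradient and divergence). Restrictions to parts of $\partial K$ are taken in the limit sense: let $B_\varepsilon,F_\varepsilon$ be the forms with the integral over $\partial K\setminus\Gamma$ replaced by the pairing over all of $\partial K$ with the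 trace factor multiplied by $\min(1,\mathrm{dist}(\cdot,\Gamma)/\varepsilon)$, and the integral over $\partial K\cap\Gamma$ by the pairing with the trace factor multiplied by $\max(0,1-\mathrm{dist}(\cdot,\Gamma)/\varepsilon)$. Since $Dw$ is only in $L^2$, the terms in $Dw$ are read through Green's identity: the two such terms of $B_\varepsilon$ on $K$ are together $\int_K Dw\cdot\nabla(\min(1,\mathrm{dist}(\cdot,\Gamma_{in})/\varepsilon)\,u)\,dx$, and the one of $F_\varepsilon$ is $-\int_K Dw\cdot\nabla(\max(0,1-\mathrm{dist}(\cdot,\Gamma_{in})/\varepsilon)\,u_{in})\,dx$ (with $u_{in}$ the extension to $\Omega_T$). Then $B(x;y)=\lim_{\varepsilon\downarrow0}B_\varepsilon(x;y)$, and an equation $F(y)-B(x;y)=r$ means $F_\varepsilon(y)-B_\varepsilon(x;y)\to r$ as $\varepsilon\downarrow0$. The energy norm is $$\|x\|_B=\sup_{y\in V\setminus\{0\}}\frac{|B(x;y)|}{\|y\|_V}.$$ **Proposition.** Let $(u,q)\in U$ solve $B((u,q);y)=F(y)$ for all $y\in V$. Let $U^h\subset U$ be a finite-dimensional affine subspace,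 $V^h\subset V$ a finite-dimensional linear subspace, and let $(u^h,q^h)\in U^h$ satisfy $B((u^h,q^h);y)=F(y)$ for all $y\in V^h$. Let $(\hat e,\hat E)\in V$ be the error representation function, i.e. the Riesz representer of the residual: $$((\hat e,\hat E);y)_V=F(y)-B((u^h,q^h);y)\qquad\text{for all }y\in V.$$ Then $B((u-u^h,q-q^h);y)$ is defined for every $y\in V$, and $$\|(u-u^h,q-q^h)\|_B=\|(\hat e,\hat E)\|_V .$$ -/

import Mathlib

open MeasureTheory Filter Topology
open scoped ENNReal ContDiff Matrix

noncomputable section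

namespace AVSFE

/-! ### Space-time points, cylinders, Lipschitz domains -/

/-- Space-time `ℝ^N × ℝ`; the last coordinate is time. -/
abbrev ST (N : ℕ) := EuclideanSpace ℝ (Fin (N + 1))

/-- The spatial part of a space-time point. -/
def spat {N : ℕ} (x : ST N) : EuclideanSpace ℝ (Fin N) :=
  WithLp.toLp 2 (fun i => x i.castSucc)

/-- The time of a space-time point. -/
def time {N : ℕ} (x : ST N) : ℝ := x (Fin.last N)

/-- The space-time point `(ξ, t)`. -/
def pt {N : ℕ} (ξ : EuclideanSpace ℝ (Fin N)) (t : ℝ) : ST N :=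
  WithLp.toLp 2 (Fin.snoc (α := fun _ => ℝ) (fun i => ξ i) t)

/-- The space-time cylinder `Ω × (0,T)`. -/
def cylinder {N : ℕ} (Ω : Set (EuclideanSpace ℝ (Fin N))) (T : ℝ) : Set (ST N) :=
  {x | spat x ∈ Ω ∧ 0 < time x ∧ time x < T}

/-- Lipschitz boundary: near each boundary point the set is the strict epigraph, in the direction
of a unit vector `e`, of a Lipschitz function of the coordinates orthogonal to `e`. -/
def HasLipschitzBoundary {E : Type*} [NormedAddCommGroup E] [InnerProductSpace ℝ E]
    (O : Set E) : Prop :=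
  ∀ p ∈ frontier O, ∃ (e : E) (ψ : E → ℝ) (L : NNReal) (r : ℝ), ‖e‖ = 1 ∧ 0 < r ∧
    LipschitzWith L ψ ∧ (∀ (x : E) (t : ℝ), ψ (x + t • e) = ψ x) ∧
    ∀ x ∈ Metric.ball p r, (x ∈ O ↔ ψ x < inner ℝ e x)

/-! ### Square integrable functions and weak derivatives -/

/-- Real square integrable functions on `Q`. -/
abbrev L2 {N : ℕ} (Q : Set (ST N)) := Lp ℝ 2 ((volume : Measure (ST N)).restrict Q)

/-- Square integrable vector fields with `n` components on `Q`. -/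
abbrev L2v {N : ℕ} (Q : Set (ST N)) (n : ℕ) :=
  Lp (EuclideanSpace ℝ (Fin n)) 2 ((volume : Measure (ST N)).restrict Q)

/-- The classical partial derivative `∂φ/∂x_i`. -/
def partialD {N : ℕ} (i : Fin (N + 1)) (φ : ST N → ℝ) (x : ST N) : ℝ :=
  fderiv ℝ φ x (EuclideanSpace.single i 1)

/-- Test functions `C_c^∞(K)`. -/
def IsTest {N : ℕ} (K : Set (ST N)) (φ : ST N → ℝ) : Prop :=
  ContDiff ℝ ∞ φ ∧ HasCompactSupport φ ∧ tsupport φ ⊆ K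

theorem IsTest.memLp {N : ℕ} {K : Set (ST N)} {φ : ST N → ℝ} (h : IsTest K φ)
    (μ : Measure (ST N)) [IsFiniteMeasureOnCompacts μ] : MemLp φ 2 μ :=
  h.1.continuous.memLp_of_hasCompactSupport h.2.1

theorem IsTest.memLp_partialD {N : ℕ} {K : Set (ST N)} {φ : ST N → ℝ} (h : IsTest K φ)
    (i : Fin (N + 1)) (μ : Measure (ST N)) [IsFiniteMeasureOnCompacts μ] :
    MemLp (partialD i φ) 2 μ :=
  ((h.1.continuous_fderiv (by simp)).clm_apply continuous_const).memLp_of_hasCompactSupport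
    (h.2.1.fderiv_apply ℝ _)

/-- The broken space `H¹` over a family `K` of open subsets of `Q`, as the graph of the weak
space-time gradient: pairs `(v, ∇v)` in `L²(Q) × L²(Q)^(N+1)` such that on every `K m` the second
entry is the weak gradient of the first. For a family with the single member `Q` it is `H¹(Q)`. -/
def H1 {N : ℕ} (Q : Set (ST N)) {κ : Type*} (K : κ → Set (ST N)) :
    Submodule ℝ (L2 Q × L2v Q (N + 1)) where
  carrier := {p | ∀ m i φ, IsTest (K m) φ →
    ∫ x in Q, p.1 x * partialD i φ x = -∫ x in Q, p.2 x i * φ x}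
  zero_mem' := by
    intro m i φ _
    have h1 : ∫ x in Q, (0 : L2 Q) x * partialD i φ x = ∫ x in Q, (0 : ℝ) := by
      refine integral_congr_ae ?_
      filter_upwards [Lp.coeFn_zero ℝ 2 ((volume : Measure (ST N)).restrict Q)] with x hx
      rw [hx]; simp
    have h2 : ∫ x in Q, (0 : L2v Q (N + 1)) x i * φ x = ∫ x in Q, (0 : ℝ) := by
      refine integral_congr_ae ?_
      filter_upwards [Lp.coeFn_zero (EuclideanSpace ℝ (Fin (N + 1))) 2
        ((volume : Measure (ST N)).restrict Q)] with x hx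
      rw [hx]; simp
    simp only [Prod.fst_zero, Prod.snd_zero]
    rw [h1, h2]; simp
  add_mem' := by
    intro a b ha hb m i φ hφ
    have e1 : ∫ x in Q, (a.1 + b.1 : L2 Q) x * partialD i φ x
        = ∫ x in Q, (a.1 x * partialD i φ x + b.1 x * partialD i φ x) := by
      refine integral_congr_ae ?_
      filter_upwards [Lp.coeFn_add a.1 b.1] with x hx
      rw [hx, Pi.add_apply, add_mul]
    have e2 : ∫ x in Q, (a.2 + b.2 : L2v Q (N + 1)) x i * φ x
        = ∫ x in Q, (a.2 x i * φ x + b.2 x i * φ x) := by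
      refine integral_congr_ae ?_
      filter_upwards [Lp.coeFn_add a.2 b.2] with x hx
      rw [hx, Pi.add_apply, PiLp.add_apply, add_mul]
    have hd := hφ.memLp_partialD i ((volume : Measure (ST N)).restrict Q)
    have hf := hφ.memLp ((volume : Measure (ST N)).restrict Q)
    have ia : Integrable (fun x => a.1 x * partialD i φ x) (volume.restrict Q) :=
      (Lp.memLp a.1).integrable_mul hd
    have ib : Integrable (fun x => b.1 x * partialD i φ x) (volume.restrict Q) :=
      (Lp.memLp b.1).integrable_mul hd
    have ja : Integrable (fun x => a.2 x i * φ x) (volume.restrict Q) :=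
      ((Lp.memLp a.2).eval_piLp i).integrable_mul hf
    have jb : Integrable (fun x => b.2 x i * φ x) (volume.restrict Q) :=
      ((Lp.memLp b.2).eval_piLp i).integrable_mul hf
    simp only [Prod.fst_add, Prod.snd_add]
    rw [e1, e2, integral_add ia ib, integral_add ja jb, ha m i φ hφ, hb m i φ hφ]
    ring
  smul_mem' := by
    intro c a ha m i φ hφ
    have e1 : ∫ x in Q, (c • a.1 : L2 Q) x * partialD i φ x
        = ∫ x in Q, c * (a.1 x * partialD i φ x) := by
      refine integral_congr_ae ?_
      filter_upwards [Lp.coeFn_smul c a.1] with x hx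
      rw [hx, Pi.smul_apply, smul_eq_mul, mul_assoc]
    have e2 : ∫ x in Q, (c • a.2 : L2v Q (N + 1)) x i * φ x
        = ∫ x in Q, c * (a.2 x i * φ x) := by
      refine integral_congr_ae ?_
      filter_upwards [Lp.coeFn_smul c a.2] with x hx
      rw [hx, Pi.smul_apply, PiLp.smul_apply, smul_eq_mul, mul_assoc]
    simp only [Prod.smul_fst, Prod.smul_snd]
    rw [e1, e2, integral_const_mul, integral_const_mul, ha m i φ hφ]
    ring

/-- The broken space `H(div)` over a family `K` of open subsets of `Q`, as the graph of the weak
divergence: pairs `(w, div w)` in `L²(Q)^n × L²(Q)` such that on every `K m` the second entry is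
the weak divergence of the first. The `j`-th component of `w` is in the direction of the
coordinate `c j`: `c = Fin.castSucc` gives spatial fields and the spatial divergence, `c = id`
space-time fields and the space-time divergence. -/
def Hdiv {N : ℕ} (Q : Set (ST N)) {n : ℕ} (c : Fin n → Fin (N + 1)) {κ : Type*}
    (K : κ → Set (ST N)) : Submodule ℝ (L2v Q n × L2 Q) where
  carrier := {p | ∀ m φ, IsTest (K m) φ →
    ∑ j, ∫ x in Q, p.1 x j * partialD (c j) φ x = -∫ x in Q, p.2 x * φ x}
  zero_mem' := by
    intro m φ _
    have h1 : ∀ j, ∫ x in Q, (0 : L2v Q n) x j * partialD (c j) φ x = ∫ x in Q, (0 : ℝ) := by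
      intro j
      refine integral_congr_ae ?_
      filter_upwards [Lp.coeFn_zero (EuclideanSpace ℝ (Fin n)) 2
        ((volume : Measure (ST N)).restrict Q)] with x hx
      rw [hx]; simp
    have h2 : ∫ x in Q, (0 : L2 Q) x * φ x = ∫ x in Q, (0 : ℝ) := by
      refine integral_congr_ae ?_
      filter_upwards [Lp.coeFn_zero ℝ 2 ((volume : Measure (ST N)).restrict Q)] with x hx
      rw [hx]; simp
    simp only [Prod.fst_zero, Prod.snd_zero]
    rw [Finset.sum_congr rfl (fun j _ => h1 j), h2]; simp
  add_mem' := by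
    intro a b ha hb m φ hφ
    have hf := hφ.memLp ((volume : Measure (ST N)).restrict Q)
    have e1 : ∀ j, ∫ x in Q, (a.1 + b.1 : L2v Q n) x j * partialD (c j) φ x
        = (∫ x in Q, a.1 x j * partialD (c j) φ x)
          + ∫ x in Q, b.1 x j * partialD (c j) φ x := by
      intro j
      have hd := hφ.memLp_partialD (c j) ((volume : Measure (ST N)).restrict Q)
      have ia : Integrable (fun x => a.1 x j * partialD (c j) φ x) (volume.restrict Q) :=
        ((Lp.memLp a.1).eval_piLp j).integrable_mul hd
      have ib : Integrable (fun x => b.1 x j * partialD (c j) φ x) (volume.restrict Q) :=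
        ((Lp.memLp b.1).eval_piLp j).integrable_mul hd
      rw [← integral_add ia ib]
      refine integral_congr_ae ?_
      filter_upwards [Lp.coeFn_add a.1 b.1] with x hx
      rw [hx, Pi.add_apply, PiLp.add_apply, add_mul]
    have e2 : ∫ x in Q, (a.2 + b.2 : L2 Q) x * φ x
        = (∫ x in Q, a.2 x * φ x) + ∫ x in Q, b.2 x * φ x := by
      have ia : Integrable (fun x => a.2 x * φ x) (volume.restrict Q) :=
        (Lp.memLp a.2).integrable_mul hf
      have ib : Integrable (fun x => b.2 x * φ x) (volume.restrict Q) :=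
        (Lp.memLp b.2).integrable_mul hf
      rw [← integral_add ia ib]
      refine integral_congr_ae ?_
      filter_upwards [Lp.coeFn_add a.2 b.2] with x hx
      rw [hx, Pi.add_apply, add_mul]
    simp only [Prod.fst_add, Prod.snd_add]
    rw [Finset.sum_congr rfl (fun j _ => e1 j), Finset.sum_add_distrib, e2, ha m φ hφ, hb m φ hφ]
    ring
  smul_mem' := by
    intro t a ha m φ hφ
    have e1 : ∀ j, ∫ x in Q, (t • a.1 : L2v Q n) x j * partialD (c j) φ x
        = t * ∫ x in Q, a.1 x j * partialD (c j) φ x := by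
      intro j
      rw [← integral_const_mul]
      refine integral_congr_ae ?_
      filter_upwards [Lp.coeFn_smul t a.1] with x hx
      rw [hx, Pi.smul_apply, PiLp.smul_apply, smul_eq_mul, mul_assoc]
    have e2 : ∫ x in Q, (t • a.2 : L2 Q) x * φ x = t * ∫ x in Q, a.2 x * φ x := by
      rw [← integral_const_mul]
      refine integral_congr_ae ?_
      filter_upwards [Lp.coeFn_smul t a.2] with x hx
      rw [hx, Pi.smul_apply, smul_eq_mul, mul_assoc]
    simp only [Prod.smul_fst, Prod.smul_snd]
    rw [Finset.sum_congr rfl (fun j _ => e1 j), ← Finset.mul_sum, e2, ha m φ hφ]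
    ring

/-! ### Traces, normal traces and integrals over parts of the boundary -/

/-- A real function together with its (weak) space-time gradient. -/
structure Jet (N : ℕ) where
  val : ST N → ℝ
  grad : Fin (N + 1) → ST N → ℝ

/-- Products, by the product rule. -/
def Jet.mul {N : ℕ} (y z : Jet N) : Jet N where
  val x := y.val x * z.val x
  grad i x := y.grad i x * z.val x + y.val x * z.grad i x

/-- The jet of an element `(v, ∇v)` of `H¹`. -/
def jet {N : ℕ} {Q : Set (ST N)} (p : L2 Q × L2v Q (N + 1)) : Jet N where
  val x := p.1 x
  grad i x := p.2 x i

/-- The Lipschitz cut-off `max 0 (1 - dist(x,Γ)/ε)`, which is `1` on `Γ` and `0` at distance at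
least `ε` from `Γ` (and `0` everywhere if `Γ` is empty). -/
def near {N : ℕ} (Γ : Set (ST N)) (ε : ℝ) : Jet N where
  val x := (thickenedIndicatorAux ε Γ x).toReal
  grad i x := partialD i (fun y => (thickenedIndicatorAux ε Γ y).toReal) x

/-- The complementary cut-off `min 1 (dist(x,Γ)/ε)`. -/
def away {N : ℕ} (Γ : Set (ST N)) (ε : ℝ) : Jet N where
  val x := 1 - (near Γ ε).val x
  grad i x := -(near Γ ε).grad i x

/-- The duality pairing `⟨γ_n(p), γ_0(z)⟩` over the whole boundary of `K` of the normal trace of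
`p = (w, div w)` with the trace of `z`, defined by Green's identity
`∫_K (w · ∇z + z div w)`.

The integral `∮_{∂K \ Γ} γ_n(p) γ_0(z)` over a part of the boundary is the limit, as `ε` tends
to `0`, of the pairing with the trace of `away Γ ε · z`; the integral over `∂K ∩ Γ` is the limit
of the pairing with the trace of `near Γ ε · z`. -/
def normalPairing {N : ℕ} {Q : Set (ST N)} (K : Set (ST N)) {n : ℕ} (c : Fin n → Fin (N + 1))
    (p : L2v Q n × L2 Q) (z : Jet N) : ℝ :=
  ∫ x in K, ((∑ j, p.1 x j * z.grad (c j) x) + p.2 x * z.val x)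

/-! ### Geometry and data -/

/-- The space-time domain, its boundary parts, and a finite partition into elements. -/
structure Geometry (N : ℕ) (ι : Type*) where
  Ω : Set (EuclideanSpace ℝ (Fin N))
  T : ℝ
  isOpen_Ω : IsOpen Ω
  nonempty_Ω : Ω.Nonempty
  bounded_Ω : Bornology.IsBounded Ω
  lipschitz_Ω : HasLipschitzBoundary Ω
  T_pos : 0 < T
  /-- the inflow part of the lateral boundary -/
  Γin : Set (ST N)
  /-- the outflow part of the lateral boundary -/
  Γout : Set (ST N)
  Γin_subset : Γin ⊆ {x | spat x ∈ frontier Ω ∧ 0 < time x ∧ time x < T}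
  Γout_subset : Γout ⊆ {x | spat x ∈ frontier Ω ∧ 0 < time x ∧ time x < T}
  disjoint_Γ : Disjoint Γin Γout
  null_Γin : μH[(N : ℝ)] (closure Γin \ Γin) = 0
  null_Γout : μH[(N : ℝ)] (closure Γout \ Γout) = 0
  boundary_eq : frontier (cylinder Ω T) = closure
    (Γin ∪ Γout ∪ {x | spat x ∈ Ω ∧ time x = 0} ∪ {x | spat x ∈ Ω ∧ time x = T})
  /-- the elements -/
  K : ι → Set (ST N)
  isOpen_K : ∀ m, IsOpen (K m)
  nonempty_K : ∀ m, (K m).Nonempty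
  lipschitz_K : ∀ m, HasLipschitzBoundary (K m)
  disjoint_K : Pairwise (fun m m' => Disjoint (K m) (K m'))
  cover : cylinder Ω T = interior (⋃ m, closure (K m))

namespace Geometry

variable {N : ℕ} {ι : Type*}

/-- The space-time domain `Ω_T`. -/
abbrev Q (G : Geometry N ι) : Set (ST N) := cylinder G.Ω G.T

/-- Pairs `((u, ∇u), (q, div q))`: a scalar function with its gradient and a spatial vector field
with its spatial divergence. -/
abbrev Pair (G : Geometry N ι) :=
  (L2 G.Q × L2v G.Q (N + 1)) × (L2v G.Q N × L2 G.Q)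

/-- `H¹(Ω_T) × H(div)`. -/
def globalSpace (G : Geometry N ι) : Submodule ℝ G.Pair :=
  (H1 G.Q (fun _ : Unit => G.Q)).prod (Hdiv G.Q Fin.castSucc (fun _ : Unit => G.Q))

/-- The broken test space `V = H¹(P_h) × H(div, P_h)`. -/
def testSpace (G : Geometry N ι) : Submodule ℝ G.Pair :=
  (H1 G.Q G.K).prod (Hdiv G.Q Fin.castSucc G.K)

/-- The element size `h_m`. -/
def h (G : Geometry N ι) (m : ι) : ℝ := Metric.diam (G.K m)

/-- The inner product of `V`; gradients and divergences are spatial. -/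
def innerV [Fintype ι] (G : Geometry N ι) (y z : G.Pair) : ℝ :=
  ∑ m, ∫ x in G.K m,
    (G.h m ^ 2 * (∑ i : Fin N, y.1.2 x i.castSucc * z.1.2 x i.castSucc)
      + y.1.1 x * z.1.1 x
      + G.h m ^ 2 * (y.2.2 x * z.2.2 x)
      + ∑ i : Fin N, y.2.1 x i * z.2.1 x i)

/-- The norm of `V`. -/
def normV [Fintype ι] (G : Geometry N ι) (y : G.Pair) : ℝ := Real.sqrt (G.innerV y y)

end Geometry

/-- Coefficients, source, boundary data and initial data. -/
structure Coefficients {N : ℕ} {ι : Type*} (G : Geometry N ι) where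
  /-- the diffusion tensor -/
  D : ST N → Matrix (Fin N) (Fin N) ℝ
  measurable_D : ∀ i j, AEStronglyMeasurable (fun x => D x i j) (volume.restrict G.Q)
  bounded_D : ∃ M : ℝ, ∀ᵐ x ∂(volume.restrict G.Q), ∀ i j, |D x i j| ≤ M
  symm_D : ∀ᵐ x ∂(volume.restrict G.Q), (D x).IsSymm
  elliptic_D : ∃ α : ℝ, 0 < α ∧ ∀ᵐ x ∂(volume.restrict G.Q), ∀ ξ : Fin N → ℝ,
    α * ∑ i, ξ i ^ 2 ≤ ξ ⬝ᵥ (D x *ᵥ ξ)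
  /-- the convection field with its elementwise divergence, so that `b · n` is defined on the
  boundaries of the elements -/
  b : L2v G.Q N × L2 G.Q
  b_mem : b ∈ Hdiv G.Q Fin.castSucc G.K
  /-- the convective terms are integrable -/
  b_mul : ∀ v ∈ H1 G.Q G.K, MemLp (fun x => v.1 x • b.1 x) 2 (volume.restrict G.Q)
  div_b_mul : ∀ v ∈ H1 G.Q G.K, MemLp (fun x => v.1 x * b.2 x) 2 (volume.restrict G.Q)
  /-- the source -/
  f : L2 G.Q
  /-- a function in `H¹(Ω_T)` whose trace is the Dirichlet datum on `Γin` -/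
  uin : L2 G.Q × L2v G.Q (N + 1)
  uin_mem : uin ∈ H1 G.Q (fun _ : Unit => G.Q)
  /-- a field in `H(div, Ω_T)` (space-time divergence) whose normal trace is the Neumann datum on
  `Γout`; the normal traces of such fields are exactly the elements of `H^{-1/2}` -/
  g : L2v G.Q (N + 1) × L2 G.Q
  g_mem : g ∈ Hdiv G.Q id (fun _ : Unit => G.Q)
  /-- the initial datum -/
  u0 : Lp ℝ 2 ((volume : Measure (EuclideanSpace ℝ (Fin N))).restrict G.Ω)

namespace Coefficients

variable {N : ℕ} {ι : Type*} {G : Geometry N ι}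

/-- The trial space `U(Ω_T)`: elements of `H¹(Ω_T) × H(div)` whose first component has the trace
`u0` on `Ω × {0}`, the latter expressed by Green's identity in time. -/
def trialSpace (P : Coefficients G) : Set G.Pair :=
  {x | x ∈ G.globalSpace ∧ ∀ φ : ST N → ℝ, IsTest {y | spat y ∈ G.Ω ∧ time y < G.T} φ →
    ∫ y in G.Q, (x.1.1 y * partialD (Fin.last N) φ y + x.1.2 y (Fin.last N) * φ y)
      = -∫ ξ in G.Ω, P.u0 ξ * φ (pt ξ 0)}

/-- `∫_K (D w) · ∇z`. By Green's identity this is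
`∫_K -z ∇·(D w) + ∮_{∂K} γ_n(D w) γ_0(z)`, and it gives a meaning to this sum also when `D w` is
only square integrable. -/
def diffusive (P : Coefficients G) (K : Set (ST N)) (w : L2v G.Q N) (z : Jet N) : ℝ :=
  ∫ x in K, ∑ i : Fin N, (P.D x *ᵥ (fun j => w x j)) i * z.grad i.castSucc x

/-- Sanity check of `diffusive` against the normal trace pairing: if `D w` coincides on `K` with a
field `p` that has a divergence, the two sides of Green's identity agree. -/
theorem diffusive_eq (P : Coefficients G) (K : Set (ST N)) (w : L2v G.Q N) (z : Jet N)
    (p : L2v G.Q N × L2 G.Q)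
    (hp : ∀ᵐ x ∂(volume.restrict K), ∀ i, p.1 x i = (P.D x *ᵥ (fun j => w x j)) i)
    (h1 : Integrable (fun x => ∑ i : Fin N, p.1 x i * z.grad i.castSucc x) (volume.restrict K))
    (h2 : Integrable (fun x => p.2 x * z.val x) (volume.restrict K)) :
    P.diffusive K w z =
      (∫ x in K, -(z.val x * p.2 x)) + normalPairing K Fin.castSucc p z := by
  unfold diffusive normalPairing
  rw [integral_add h1 h2, integral_neg]
  have e : ∫ x in K, z.val x * p.2 x = ∫ x in K, p.2 x * z.val x := by simp only [mul_comm]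
  have e' : ∫ x in K, ∑ i : Fin N, (P.D x *ᵥ (fun j => w x j)) i * z.grad i.castSucc x
      = ∫ x in K, ∑ i : Fin N, p.1 x i * z.grad i.castSucc x := by
    refine integral_congr_ae ?_
    filter_upwards [hp] with x hx
    simp only [hx]
  rw [e, e']; ring

/-- The bilinear form with `ε`-cut-offs in place of the restrictions of the boundary integrals;
`x = (u, q)` and `y = (v, w)`. As `ε` tends to `0` it becomes the sum over the elements `K` of
`∫_K [-u ∇·(D w) - q·w + ∂_t u v + q·∇v - (b·∇v) u]`
`+ ∮_{∂K \ Γin} [(b·n) γ_0(u) γ_0(v) + γ_n(D w) γ_0(u)] - ∮_{∂K \ Γout} γ_n(q) γ_0(v)`. -/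
def Bcut [Fintype ι] (P : Coefficients G) (ε : ℝ) (x y : G.Pair) : ℝ :=
  ∑ m, ((∫ s in G.K m,
        (-(∑ i : Fin N, x.2.1 s i * y.2.1 s i)
          + x.1.2 s (Fin.last N) * y.1.1 s
          + (∑ i : Fin N, x.2.1 s i * y.1.2 s i.castSucc)
          - (∑ i : Fin N, P.b.1 s i * y.1.2 s i.castSucc) * x.1.1 s))
      + P.diffusive (G.K m) y.2.1 ((away G.Γin ε).mul (jet x.1))
      + normalPairing (G.K m) Fin.castSucc P.b ((away G.Γin ε).mul ((jet x.1).mul (jet y.1)))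
      - normalPairing (G.K m) Fin.castSucc x.2 ((away G.Γout ε).mul (jet y.1)))

/-- The linear functional with `ε`-cut-offs. As `ε` tends to `0` it becomes the sum over the
elements `K` of
`∫_K f v + ∮_{∂K ∩ Γout} g γ_0(v) - ∮_{∂K ∩ Γin} [uin γ_n(D w) + (b·n) uin γ_0(v)]`. -/
def Fcut [Fintype ι] (P : Coefficients G) (ε : ℝ) (y : G.Pair) : ℝ :=
  ∑ m, ((∫ s in G.K m, P.f s * y.1.1 s)
      + normalPairing (G.K m) id P.g ((near G.Γout ε).mul (jet y.1))
      - P.diffusive (G.K m) y.2.1 ((near G.Γin ε).mul (jet P.uin))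
      - normalPairing (G.K m) Fin.castSucc P.b
          ((near G.Γin ε).mul ((jet P.uin).mul (jet y.1))))

/-- The residual `F(y) - B(x; y)` is defined and has the value `r`. -/
def HasResidual [Fintype ι] (P : Coefficients G) (x y : G.Pair) (r : ℝ) : Prop :=
  Tendsto (fun ε => P.Fcut ε y - P.Bcut ε x y) (𝓝[>] 0) (𝓝 r)

/-- The bilinear form `B(x; y)`. -/
def B [Fintype ι] (P : Coefficients G) (x y : G.Pair) : ℝ :=
  limUnder (𝓝[>] 0) (fun ε => P.Bcut ε x y)

/-- The energy norm `sup_{y ∈ V \ {0}} |B(x; y)| / ‖y‖_V`, with values in `[0, ∞]`. -/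
def energyNorm [Fintype ι] (P : Coefficients G) (x : G.Pair) : ℝ≥0∞ :=
  ⨆ y ∈ G.testSpace, ⨆ _ : y ≠ 0, ENNReal.ofReal |P.B x y| / ENNReal.ofReal (G.normV y)

/-- `x ∈ U(Ω_T)` solves the weak formulation: `B(x; y) = F(y)` for all `y ∈ V`. -/
def IsWeakSolution [Fintype ι] (P : Coefficients G) (x : G.Pair) : Prop :=
  x ∈ P.trialSpace ∧ ∀ y ∈ G.testSpace, P.HasResidual x y 0

/-- `xh` is the discrete solution for the trial set `Uh ⊆ U(Ω_T)` and the test space `Vh ⊆ V`,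
both finite dimensional. (`Uh` is affine because of the initial condition.) -/
structure IsDiscreteSolution [Fintype ι] (P : Coefficients G) (Uh : AffineSubspace ℝ G.Pair)
    (Vh : Submodule ℝ G.Pair) (xh : G.Pair) : Prop where
  trial_subset : (Uh : Set G.Pair) ⊆ P.trialSpace
  trial_finite : FiniteDimensional ℝ Uh.direction
  test_le : Vh ≤ G.testSpace
  test_finite : FiniteDimensional ℝ Vh
  mem : xh ∈ Uh
  eq : ∀ y ∈ Vh, P.HasResidual xh y 0

/-- `e ∈ V` is the error representation function of `xh`:
`(e; y)_V = F(y) - B(xh; y)` for all `y ∈ V`. -/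
def IsErrorRepresentation [Fintype ι] (P : Coefficients G) (xh e : G.Pair) : Prop :=
  e ∈ G.testSpace ∧ ∀ y ∈ G.testSpace, P.HasResidual xh y (G.innerV e y)

end Coefficients

end AVSFE

end

/-!
The weak solution and the discrete solution have the same load `F`, so for each cut-off parameter
`ε > 0` the residual of `xh` minus that of `x` is `Bcut ε (x - xh) y`, by linearity of `Bcut` in
its first argument (`Coefficients.Bcut_sub`). Letting `ε` tend to `0`, the limit `B(x - xh; y)`
exists for every test function `y` and equals the inner product of the error representation
function with `y` (`Coefficients.tendsto_Bcut_sub`). The energy norm of `x - xh` is therefore the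
dual norm of `(e; ·)_V`, which is `‖e‖_V`: one inequality is Cauchy-Schwarz
(`Geometry.abs_innerV_le`), the other one the choice `y = e`.

Linearity of `Bcut` is a statement about integrals, hence rests on the integrability of every
term. The cut-offs and their gradients are bounded (`isBounded_away`), since the cut-offs are
Lipschitz; the products of three functions that come from the convection field `b` are integrable
because `v b` and `v div b` are square integrable for `v` in the broken `H¹`.
-/

namespace AVSFE

/-! ### Cut-offs -/

/-- A jet with bounded measurable value and gradient. -/
def Jet.IsBounded {N : ℕ} (χ : Jet N) : Prop :=
  (Measurable χ.val ∧ ∀ i, Measurable (χ.grad i)) ∧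
    ∃ C : ℝ, ∀ x, |χ.val x| ≤ C ∧ ∀ i, |χ.grad i x| ≤ C

theorem isBounded_near {N : ℕ} (Γ : Set (ST N)) {ε : ℝ} (hε : 0 < ε) : (near Γ ε).IsBounded := by
  have hL : LipschitzWith ε.toNNReal⁻¹ (near Γ ε).val := lipschitzWith_thickenedIndicator hε Γ
  refine ⟨⟨hL.continuous.measurable, fun i => measurable_fderiv_apply_const ℝ _ _⟩,
    max 1 (ε.toNNReal⁻¹ : NNReal), fun x => ⟨?_, fun i => ?_⟩⟩
  · refine le_max_of_le_left ?_
    change |(thickenedIndicatorAux ε Γ x).toReal| ≤ 1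
    rw [abs_of_nonneg ENNReal.toReal_nonneg]
    exact ENNReal.toReal_le_of_le_ofReal zero_le_one
      (by simpa using thickenedIndicatorAux_le_one ε Γ x)
  · refine le_max_of_le_right ?_
    have h1 := (fderiv ℝ (near Γ ε).val x).le_opNorm (EuclideanSpace.single i 1)
    have h2 : ‖fderiv ℝ (near Γ ε).val x‖ ≤ _ := norm_fderiv_le_of_lipschitz ℝ hL
    rw [PiLp.norm_single, norm_one, mul_one] at h1
    exact h1.trans h2

theorem isBounded_away {N : ℕ} (Γ : Set (ST N)) {ε : ℝ} (hε : 0 < ε) : (away Γ ε).IsBounded := by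
  obtain ⟨⟨h1, h2⟩, C, hC⟩ := isBounded_near Γ hε
  refine ⟨⟨measurable_const.sub h1, fun i => (h2 i).neg⟩, 1 + C, fun x => ⟨?_, fun i => ?_⟩⟩
  · have := (abs_sub (1 : ℝ) ((near Γ ε).val x)).trans (add_le_add abs_one.le (hC x).1)
    exact this
  · have := (hC x).2 i
    change |-(near Γ ε).grad i x| ≤ 1 + C
    rw [abs_neg]
    linarith

section Integrability

variable {N n : ℕ} {Q K : Set (ST N)}

theorem Jet.IsBounded.integrable_val_mul {χ : Jet N} (hχ : χ.IsBounded) {μ : Measure (ST N)}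
    {f : ST N → ℝ} (hf : Integrable f μ) : Integrable (fun x => χ.val x * f x) μ := by
  obtain ⟨⟨h1, -⟩, C, hC⟩ := hχ
  exact hf.bdd_mul (c := C) h1.aestronglyMeasurable (ae_of_all _ fun x => (hC x).1)

theorem Jet.IsBounded.integrable_grad_mul {χ : Jet N} (hχ : χ.IsBounded) {μ : Measure (ST N)}
    {f : ST N → ℝ} (hf : Integrable f μ) (i : Fin (N + 1)) :
    Integrable (fun x => χ.grad i x * f x) μ := by
  obtain ⟨⟨-, h1⟩, C, hC⟩ := hχ
  exact hf.bdd_mul (c := C) (h1 i).aestronglyMeasurable (ae_of_all _ fun x => (hC x).2 i)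

/-! ### Elements of `L²` on subsets of the domain -/

theorem memLp_restrict (hK : K ⊆ Q) (p : L2 Q) : MemLp (fun x => p x) 2 (volume.restrict K) :=
  (Lp.memLp p).mono_measure (Measure.restrict_mono hK le_rfl)

theorem memLp_apply_restrict (hK : K ⊆ Q) (p : L2v Q n) (i : Fin n) :
    MemLp (fun x => p x i) 2 (volume.restrict K) :=
  ((Lp.memLp p).eval_piLp i).mono_measure (Measure.restrict_mono hK le_rfl)

theorem ae_sub_apply (hK : K ⊆ Q) (p q : L2 Q) :
    ∀ᵐ x ∂(volume.restrict K), (p - q) x = p x - q x := by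
  filter_upwards [ae_restrict_of_ae_restrict_of_subset hK (Lp.coeFn_sub p q)] with x hx
  rw [hx, Pi.sub_apply]

theorem ae_sub_apply_apply (hK : K ⊆ Q) (p q : L2v Q n) :
    ∀ᵐ x ∂(volume.restrict K), ∀ i, (p - q) x i = p x i - q x i := by
  filter_upwards [ae_restrict_of_ae_restrict_of_subset hK (Lp.coeFn_sub p q)] with x hx i
  rw [hx, Pi.sub_apply, PiLp.sub_apply]

/-! ### Linearity of the boundary pairings -/

/-- The integrand of `normalPairing`. -/
noncomputable def pairingDensity (c : Fin n → Fin (N + 1)) (p : L2v Q n × L2 Q) (z : Jet N) (x : ST N) : ℝ :=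
  (∑ j, p.1 x j * z.grad (c j) x) + p.2 x * z.val x

theorem integrable_pairingDensity (hK : K ⊆ Q) (c : Fin n → Fin (N + 1)) (p : L2v Q n × L2 Q)
    {χ : Jet N} (hχ : χ.IsBounded) (v : L2 Q × L2v Q (N + 1)) :
    Integrable (pairingDensity c p (χ.mul (jet v))) (volume.restrict K) := by
  refine (integrable_finsetSum _ fun j _ => ?_).add ?_
  · have h1 := hχ.integrable_grad_mul
      ((memLp_apply_restrict hK p.1 j).integrable_mul (memLp_restrict hK v.1)) (c j)
    have h2 := hχ.integrable_val_mul
      ((memLp_apply_restrict hK p.1 j).integrable_mul (memLp_apply_restrict hK v.2 (c j)))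
    refine (h1.add h2).congr (ae_of_all _ fun x => ?_)
    simp only [Jet.mul, jet, Pi.add_apply, Pi.mul_apply]
    ring
  · refine (hχ.integrable_val_mul
      ((memLp_restrict hK p.2).integrable_mul (memLp_restrict hK v.1))).congr
      (ae_of_all _ fun x => ?_)
    simp only [Jet.mul, jet, Pi.mul_apply]
    ring

theorem normalPairing_sub_field (hK : K ⊆ Q) (c : Fin n → Fin (N + 1)) (p p' : L2v Q n × L2 Q)
    {χ : Jet N} (hχ : χ.IsBounded) (v : L2 Q × L2v Q (N + 1)) :
    normalPairing K c (p - p') (χ.mul (jet v))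
      = normalPairing K c p (χ.mul (jet v)) - normalPairing K c p' (χ.mul (jet v)) := by
  refine Eq.trans ?_ (integral_sub (integrable_pairingDensity hK c p hχ v)
    (integrable_pairingDensity hK c p' hχ v))
  refine integral_congr_ae ?_
  filter_upwards [ae_sub_apply hK p.2 p'.2, ae_sub_apply_apply hK p.1 p'.1] with x h1 h2
  simp only [Prod.fst_sub, Prod.snd_sub, h1, h2, sub_mul, Finset.sum_sub_distrib]
  ring

end Integrability

/-! ### The inner product of the test space -/

namespace Geometry

variable {N : ℕ} {ι : Type*} (G : Geometry N ι)

theorem element_subset (m : ι) : G.K m ⊆ G.Q := by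
  change G.K m ⊆ cylinder G.Ω G.T
  rw [G.cover]
  exact interior_maximal (subset_closure.trans (Set.subset_iUnion (fun m => closure (G.K m)) m))
    (G.isOpen_K m)

theorem mem_broken_H1 {p : L2 G.Q × L2v G.Q (N + 1)} (hp : p ∈ H1 G.Q (fun _ : Unit => G.Q)) :
    p ∈ H1 G.Q G.K :=
  fun m i φ hφ => hp () i φ ⟨hφ.1, hφ.2.1, hφ.2.2.trans (G.element_subset m)⟩

/-- The integrand of the inner product of `V` on the element `K m`. -/
noncomputable def innerDensity (m : ι) (y z : G.Pair) (x : ST N) : ℝ :=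
  G.h m ^ 2 * (∑ i : Fin N, y.1.2 x i.castSucc * z.1.2 x i.castSucc)
    + y.1.1 x * z.1.1 x
    + G.h m ^ 2 * (y.2.2 x * z.2.2 x)
    + ∑ i : Fin N, y.2.1 x i * z.2.1 x i

theorem integrable_innerDensity (m : ι) (y z : G.Pair) :
    Integrable (G.innerDensity m y z) (volume.restrict (G.K m)) := by
  have hK := G.element_subset m
  refine ((((integrable_finsetSum _ fun i _ => ?_).const_mul _).add ?_).add
    (Integrable.const_mul ?_ _)).add (integrable_finsetSum _ fun i _ => ?_)
  · exact (memLp_apply_restrict hK y.1.2 _).integrable_mul (memLp_apply_restrict hK z.1.2 _)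
  · exact (memLp_restrict hK y.1.1).integrable_mul (memLp_restrict hK z.1.1)
  · exact (memLp_restrict hK y.2.2).integrable_mul (memLp_restrict hK z.2.2)
  · exact (memLp_apply_restrict hK y.2.1 _).integrable_mul (memLp_apply_restrict hK z.2.1 _)

/-- Positivity of `(t • y + z; t • y + z)_V`, expanded pointwise as a polynomial in `t`. -/
theorem innerDensity_quadratic_nonneg (m : ι) (y z : G.Pair) (t : ℝ) (x : ST N) :
    0 ≤ t * t * G.innerDensity m y y x + 2 * t * G.innerDensity m y z x
      + G.innerDensity m z z x := by
  have e : t * t * G.innerDensity m y y x + 2 * t * G.innerDensity m y z x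
      + G.innerDensity m z z x
      = G.h m ^ 2 * (∑ i : Fin N, (t * y.1.2 x i.castSucc + z.1.2 x i.castSucc) ^ 2)
        + (t * y.1.1 x + z.1.1 x) ^ 2
        + G.h m ^ 2 * (t * y.2.2 x + z.2.2 x) ^ 2
        + ∑ i : Fin N, (t * y.2.1 x i + z.2.1 x i) ^ 2 := by
    have key : ∀ a b : Fin N → ℝ, ∑ i, (t * a i + b i) ^ 2
        = t * t * ∑ i, a i * a i + 2 * t * ∑ i, a i * b i + ∑ i, b i * b i := by
      intro a b
      simp only [Finset.mul_sum, ← Finset.sum_add_distrib]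
      exact Finset.sum_congr rfl fun i _ => by ring
    simp only [innerDensity, key]
    ring
  rw [e]
  positivity

variable [Fintype ι]

theorem innerV_quadratic_nonneg (y z : G.Pair) (t : ℝ) :
    0 ≤ G.innerV y y * (t * t) + 2 * G.innerV y z * t + G.innerV z z := by
  have e : G.innerV y y * (t * t) + 2 * G.innerV y z * t + G.innerV z z
      = ∑ m, ∫ x in G.K m, (t * t * G.innerDensity m y y x + 2 * t * G.innerDensity m y z x
        + G.innerDensity m z z x) := by
    have h : ∀ m, ∫ x in G.K m, (t * t * G.innerDensity m y y x + 2 * t * G.innerDensity m y z x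
        + G.innerDensity m z z x) = t * t * (∫ x in G.K m, G.innerDensity m y y x)
          + 2 * t * (∫ x in G.K m, G.innerDensity m y z x)
          + ∫ x in G.K m, G.innerDensity m z z x := by
      intro m
      have h1 := (G.integrable_innerDensity m y y).const_mul (t * t)
      have h2 := (G.integrable_innerDensity m y z).const_mul (2 * t)
      rw [← integral_const_mul, ← integral_const_mul, ← integral_add h1 h2]
      exact integral_add (h1.add h2) (G.integrable_innerDensity m z z)
    simp only [h, Finset.sum_add_distrib, ← Finset.mul_sum]
    simp only [innerV, innerDensity]
    ring
  rw [e]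
  exact Finset.sum_nonneg fun m _ =>
    integral_nonneg fun x => G.innerDensity_quadratic_nonneg m y z t x

theorem innerV_self_nonneg (y : G.Pair) : 0 ≤ G.innerV y y := by
  simpa using G.innerV_quadratic_nonneg y y 0

/-- The Cauchy-Schwarz inequality in `V`. -/
theorem abs_innerV_le (y z : G.Pair) : |G.innerV y z| ≤ G.normV y * G.normV z := by
  have h := discrim_le_zero (G.innerV_quadratic_nonneg y z)
  rw [discrim] at h
  rw [normV, normV, ← Real.sqrt_mul (G.innerV_self_nonneg y)]
  exact Real.abs_le_sqrt (by linarith)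

theorem innerV_zero_left (z : G.Pair) : G.innerV 0 z = 0 := by
  have h0 : G.innerV 0 0 = 0 := by
    refine Finset.sum_eq_zero fun m _ => ?_
    rw [← integral_zero (ST N) ℝ (μ := volume.restrict (G.K m))]
    have hK := G.element_subset m
    refine integral_congr_ae ?_
    -- `ae_sub_apply` for `0 - 0` gives the values of the zero classes
    filter_upwards [ae_sub_apply hK (0 : L2 G.Q) 0,
      ae_sub_apply_apply hK (0 : L2v G.Q N) 0,
      ae_sub_apply_apply hK (0 : L2v G.Q (N + 1)) 0] with x h1 h2 h3
    simp only [sub_self] at h1 h2 h3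
    simp only [Prod.fst_zero, Prod.snd_zero, h1, h2, h3, mul_zero, Finset.sum_const_zero, add_zero]
  simpa [normV, h0] using G.abs_innerV_le 0 z

end Geometry

/-! ### Linearity of the bilinear form in the trial function -/

namespace Coefficients

variable {N : ℕ} {ι : Type*} {G : Geometry N ι} (P : Coefficients G)

theorem memLp_mul_b {K : Set (ST N)} (hK : K ⊆ G.Q) {v : L2 G.Q × L2v G.Q (N + 1)}
    (hv : v ∈ H1 G.Q G.K) (j : Fin N) :
    MemLp (fun x => v.1 x * P.b.1 x j) 2 (volume.restrict K) :=
  ((P.b_mul v hv).eval_piLp j).mono_measure (Measure.restrict_mono hK le_rfl)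

/-- The integrand of `diffusive`. -/
noncomputable def diffusiveDensity (w : L2v G.Q N) (z : Jet N) (x : ST N) : ℝ :=
  ∑ i : Fin N, (P.D x *ᵥ (fun j => w x j)) i * z.grad i.castSucc x

theorem memLp_diffusion {K : Set (ST N)} (hK : K ⊆ G.Q) (w : L2v G.Q N) (i : Fin N) :
    MemLp (fun x => (P.D x *ᵥ (fun j => w x j)) i) 2 (volume.restrict K) := by
  refine MemLp.mono_measure (Measure.restrict_mono hK le_rfl) ?_
  obtain ⟨M, hM⟩ := P.bounded_D
  change MemLp (fun x => ∑ j, P.D x i j * w x j) 2 _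
  refine memLp_finsetSum _ fun j _ => ?_
  refine (memLp_apply_restrict subset_rfl w j).of_le_mul (c := M)
    ((P.measurable_D i j).mul (memLp_apply_restrict subset_rfl w j).1) ?_
  filter_upwards [hM] with x hx
  rw [norm_mul]
  exact mul_le_mul_of_nonneg_right (hx i j) (norm_nonneg _)

theorem integrable_diffusiveDensity {K : Set (ST N)} (hK : K ⊆ G.Q) (w : L2v G.Q N)
    {χ : Jet N} (hχ : χ.IsBounded) (u : L2 G.Q × L2v G.Q (N + 1)) :
    Integrable (P.diffusiveDensity w (χ.mul (jet u))) (volume.restrict K) := by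
  refine integrable_finsetSum _ fun i _ => ?_
  have h1 := hχ.integrable_grad_mul
    ((P.memLp_diffusion hK w i).integrable_mul (memLp_restrict hK u.1)) i.castSucc
  have h2 := hχ.integrable_val_mul
    ((P.memLp_diffusion hK w i).integrable_mul (memLp_apply_restrict hK u.2 i.castSucc))
  refine (h1.add h2).congr (ae_of_all _ fun x => ?_)
  simp only [Jet.mul, jet, Pi.add_apply, Pi.mul_apply]
  ring

theorem diffusive_sub {K : Set (ST N)} (hK : K ⊆ G.Q) (w : L2v G.Q N)
    {χ : Jet N} (hχ : χ.IsBounded) (u u' : L2 G.Q × L2v G.Q (N + 1)) :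
    P.diffusive K w (χ.mul (jet (u - u')))
      = P.diffusive K w (χ.mul (jet u)) - P.diffusive K w (χ.mul (jet u')) := by
  refine Eq.trans ?_ (integral_sub (P.integrable_diffusiveDensity hK w hχ u)
    (P.integrable_diffusiveDensity hK w hχ u'))
  refine integral_congr_ae ?_
  filter_upwards [ae_sub_apply hK u.1 u'.1, ae_sub_apply_apply hK u.2 u'.2] with x h1 h2
  simp only [← Finset.sum_sub_distrib]
  refine Finset.sum_congr rfl fun i _ => ?_
  simp only [Jet.mul, jet, Prod.fst_sub, Prod.snd_sub, h1, h2]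
  ring

theorem integrable_convectiveDensity {K : Set (ST N)} (hK : K ⊆ G.Q) {χ : Jet N}
    (hχ : χ.IsBounded) {u v : L2 G.Q × L2v G.Q (N + 1)} (hu : u ∈ H1 G.Q G.K)
    (hv : v ∈ H1 G.Q G.K) :
    Integrable (pairingDensity Fin.castSucc P.b (χ.mul ((jet u).mul (jet v))))
      (volume.restrict K) := by
  refine (integrable_finsetSum _ fun j _ => ?_).add ?_
  · have h1 := hχ.integrable_grad_mul
      ((P.memLp_mul_b hK hu j).integrable_mul (memLp_restrict hK v.1)) j.castSucc
    -- in `∇(u v) = v ∇u + u ∇v` the field `b` is absorbed by the undifferentiated factor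
    have h2 := hχ.integrable_val_mul
      ((P.memLp_mul_b hK hv j).integrable_mul (memLp_apply_restrict hK u.2 j.castSucc))
    have h3 := hχ.integrable_val_mul
      ((P.memLp_mul_b hK hu j).integrable_mul (memLp_apply_restrict hK v.2 j.castSucc))
    refine ((h1.add h2).add h3).congr (ae_of_all _ fun x => ?_)
    simp only [Jet.mul, jet, Pi.add_apply, Pi.mul_apply]
    ring
  · have h := ((P.div_b_mul u hu).mono_measure (Measure.restrict_mono hK le_rfl))
    refine (hχ.integrable_val_mul (h.integrable_mul (memLp_restrict hK v.1))).congr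
      (ae_of_all _ fun x => ?_)
    simp only [Jet.mul, jet, Pi.mul_apply]
    ring

theorem convective_sub {K : Set (ST N)} (hK : K ⊆ G.Q) {χ : Jet N}
    (hχ : χ.IsBounded) {u u' v : L2 G.Q × L2v G.Q (N + 1)} (hu : u ∈ H1 G.Q G.K)
    (hu' : u' ∈ H1 G.Q G.K) (hv : v ∈ H1 G.Q G.K) :
    normalPairing K Fin.castSucc P.b (χ.mul ((jet (u - u')).mul (jet v)))
      = normalPairing K Fin.castSucc P.b (χ.mul ((jet u).mul (jet v)))
        - normalPairing K Fin.castSucc P.b (χ.mul ((jet u').mul (jet v))) := by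
  refine Eq.trans ?_ (integral_sub (P.integrable_convectiveDensity hK hχ hu hv)
    (P.integrable_convectiveDensity hK hχ hu' hv))
  refine integral_congr_ae ?_
  filter_upwards [ae_sub_apply hK u.1 u'.1, ae_sub_apply_apply hK u.2 u'.2] with x h1 h2
  simp only [add_sub_add_comm, ← Finset.sum_sub_distrib]
  congr 1
  · refine Finset.sum_congr rfl fun i _ => ?_
    simp only [Jet.mul, jet, Prod.fst_sub, Prod.snd_sub, h1, h2]
    ring
  · simp only [Jet.mul, jet, Prod.fst_sub, h1]
    ring

/-- The integrand of the volume part of `B`, without the term in `D w`. -/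
noncomputable def volumeDensity (x y : G.Pair) (s : ST N) : ℝ :=
  -(∑ i : Fin N, x.2.1 s i * y.2.1 s i)
    + x.1.2 s (Fin.last N) * y.1.1 s
    + (∑ i : Fin N, x.2.1 s i * y.1.2 s i.castSucc)
    - (∑ i : Fin N, P.b.1 s i * y.1.2 s i.castSucc) * x.1.1 s

theorem integrable_volumeDensity {K : Set (ST N)} (hK : K ⊆ G.Q) {x : G.Pair}
    (hx : x.1 ∈ H1 G.Q G.K) (y : G.Pair) :
    Integrable (P.volumeDensity x y) (volume.restrict K) := by
  refine (((integrable_finsetSum _ fun i _ => ?_).neg.add ?_).add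
    (integrable_finsetSum _ fun i _ => ?_)).sub ?_
  · exact (memLp_apply_restrict hK x.2.1 i).integrable_mul (memLp_apply_restrict hK y.2.1 i)
  · exact (memLp_apply_restrict hK x.1.2 _).integrable_mul (memLp_restrict hK y.1.1)
  · exact (memLp_apply_restrict hK x.2.1 i).integrable_mul (memLp_apply_restrict hK y.1.2 _)
  · simp only [Finset.sum_mul]
    refine integrable_finsetSum _ fun i _ => ?_
    refine ((P.memLp_mul_b hK hx i).integrable_mul
      (memLp_apply_restrict hK y.1.2 i.castSucc)).congr (ae_of_all _ fun s => ?_)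
    simp only [Pi.mul_apply]
    ring

theorem integral_volumeDensity_sub {K : Set (ST N)} (hK : K ⊆ G.Q) {x x' : G.Pair}
    (hx : x.1 ∈ H1 G.Q G.K) (hx' : x'.1 ∈ H1 G.Q G.K) (y : G.Pair) :
    ∫ s in K, P.volumeDensity (x - x') y s
      = (∫ s in K, P.volumeDensity x y s) - ∫ s in K, P.volumeDensity x' y s := by
  rw [← integral_sub (P.integrable_volumeDensity hK hx y) (P.integrable_volumeDensity hK hx' y)]
  refine integral_congr_ae ?_
  filter_upwards [ae_sub_apply hK x.1.1 x'.1.1, ae_sub_apply_apply hK x.1.2 x'.1.2,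
    ae_sub_apply_apply hK x.2.1 x'.2.1] with s h1 h2 h3
  simp only [volumeDensity, Prod.fst_sub, Prod.snd_sub, h1, h2, h3, sub_mul,
    Finset.sum_sub_distrib]
  ring

variable [Fintype ι]

theorem Bcut_sub {ε : ℝ} (hε : 0 < ε) {x x' y : G.Pair} (hx : x ∈ G.globalSpace)
    (hx' : x' ∈ G.globalSpace) (hy : y ∈ G.testSpace) :
    P.Bcut ε (x - x') y = P.Bcut ε x y - P.Bcut ε x' y := by
  unfold Bcut
  rw [← Finset.sum_sub_distrib]
  refine Finset.sum_congr rfl fun m _ => ?_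
  have hK := G.element_subset m
  have h1 := G.mem_broken_H1 hx.1
  have h1' := G.mem_broken_H1 hx'.1
  have e1 := P.integral_volumeDensity_sub hK h1 h1' y
  have e2 := P.diffusive_sub hK y.2.1 (isBounded_away G.Γin hε) x.1 x'.1
  have e3 := P.convective_sub hK (isBounded_away G.Γin hε) h1 h1' hy.1
  have e4 := normalPairing_sub_field hK Fin.castSucc x.2 x'.2 (isBounded_away G.Γout hε) y.1
  simp only [volumeDensity] at e1
  rw [e1, Prod.fst_sub x x', Prod.snd_sub x x', e2, e3, e4]
  ring

/-! ### The energy norm of the error -/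

/-- The load cancels in the difference of two residuals. -/
theorem tendsto_Bcut_sub {x xh y : G.Pair} {r r' : ℝ} (hx : x ∈ G.globalSpace)
    (hxh : xh ∈ G.globalSpace) (hy : y ∈ G.testSpace) (h : P.HasResidual x y r)
    (hh : P.HasResidual xh y r') :
    Tendsto (fun ε => P.Bcut ε (x - xh) y) (𝓝[>] 0) (𝓝 (r' - r)) := by
  refine (hh.sub h).congr' ?_
  filter_upwards [self_mem_nhdsWithin] with ε hε
  rw [P.Bcut_sub hε hx hxh hy]
  ring

/-- If `B x` is represented by `e` in the inner product of `V`, then the energy norm of `x`, being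
the dual norm of `B x`, is `‖e‖_V`: the supremum is attained at `y = e`. -/
theorem energyNorm_eq_of_B_eq_innerV {x e : G.Pair} (he : e ∈ G.testSpace)
    (h : ∀ y ∈ G.testSpace, P.B x y = G.innerV e y) :
    P.energyNorm x = ENNReal.ofReal (G.normV e) := by
  have hn : ∀ y : G.Pair, 0 ≤ G.normV y := fun y => Real.sqrt_nonneg _
  refine le_antisymm (iSup₂_le fun y hy => iSup_le fun _ => ?_) ?_
  · -- also covers `‖y‖_V = 0`, as then the numerator vanishes and `0 / 0 = 0`
    refine ENNReal.div_le_of_le_mul ?_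
    rw [h y hy, ← ENNReal.ofReal_mul (hn e)]
    exact ENNReal.ofReal_le_ofReal (G.abs_innerV_le e y)
  · rcases (hn e).eq_or_lt with h0 | h0
    · simp [← h0]
    have hne : e ≠ 0 := by
      rintro rfl
      simp [Geometry.normV, G.innerV_zero_left] at h0
    refine le_trans (le_of_eq ?_) (le_iSup₂_of_le e he (le_iSup_of_le hne le_rfl))
    rw [h e he, abs_of_nonneg (G.innerV_self_nonneg e), ← ENNReal.ofReal_div_of_pos h0,
      ← Real.mul_self_sqrt (G.innerV_self_nonneg e)]
    change _ = ENNReal.ofReal (G.normV e * G.normV e / G.normV e)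
    rw [mul_self_div_self]

end Coefficients

end AVSFE

theorem mainTheorem4 {N : ℕ} (hN : 1 ≤ N) {ι : Type*} [Fintype ι]
    (G : AVSFE.Geometry N ι) (P : AVSFE.Coefficients G)
    (x : G.Pair) (hx : P.IsWeakSolution x)
    (Uh : AffineSubspace ℝ G.Pair) (Vh : Submodule ℝ G.Pair)
    (xh : G.Pair) (hxh : P.IsDiscreteSolution Uh Vh xh)
    (e : G.Pair) (he : P.IsErrorRepresentation xh e) :
    (∀ y ∈ G.testSpace,
      Tendsto (fun ε => P.Bcut ε (x - xh) y) (𝓝[>] 0) (𝓝 (P.B (x - xh) y))) ∧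
    P.energyNorm (x - xh) = ENNReal.ofReal (G.normV e) := by
  have lim : ∀ y ∈ G.testSpace,
      Tendsto (fun ε => P.Bcut ε (x - xh) y) (𝓝[>] 0) (𝓝 (G.innerV e y)) := fun y hy => by
    simpa using P.tendsto_Bcut_sub hx.1.1 (hxh.trial_subset hxh.mem).1 hy (hx.2 y hy) (he.2 y hy)
  have hB : ∀ y ∈ G.testSpace, P.B (x - xh) y = G.innerV e y := fun y hy => (lim y hy).limUnder_eq
  exact ⟨fun y hy => by rw [hB y hy]; exact lim y hy, P.energyNorm_eq_of_B_eq_innerV he.1 hB⟩
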